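/- **Theorem T1615.** Let \(q\ge 1\), let \(\alpha\in\mathbb R\), let \(\kappa\in\{0,1,2,\dots\}\cup\{\infty\}\), and let \((s_j)_{j=0}^{\kappa}\) be a sequence of complex \(q\times q\) matrices which is \(\alpha\)-Stieltjes non-negative definite extendable, i.e. belongs to \(\mathcal K^{\ge,\mathrm e}_{q,\kappa,\alpha}\). Then the sequence \((s_0^{[j,\alpha]})_{j=0}^{\kappa}\) of the first terms of the successive \(\alpha\)-Schur–Stieltjes transforms of \((s_j)_{j=0}^{\kappa}\) is exactly the right \(\alpha\)-Stieltjes parametrization \((Q_j)_{j=0}^{\kappa}\) of \((s_j)_{j=0}^{\kappa}\); that is, \(Q_j=s_0^{[j,\alpha]}\) for every integer \(j\) with \(0\le j\le\kappa\). Here \(A^\dagger\) denotes the Moore–Penrose inverse of a complex matrix \(A\), "non-negative" means Hermitian positive semidefinite, and the following notions are used. *Classes.* Put \(H_n(s)=[s_{j+k}]_{j,k=0}^{n}\), and let \(s^{(\alpha)}_j=-\alpha s_j+s_{j+1}\) for \(0\le j\le \kappa-1\). For finite \(m\), the sequence \((s_j)_{j=0}^{m}\) belongs to \(\mathcal K^{\ge}_{q,m,\alpha}\)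 if: \(s_0\) is non-negative (case \(m=0\)); \(H_n(s)\) and \(H_{n-1}(s^{(\alpha)})\) are non-negative (case \(m=2n\), \(n\ge1\)); \(H_n(s)\) and \(H_n(s^{(\alpha)})\) are non-negative (case \(m=2n+1\), \(n\ge0\)). For finite \(\kappa\), \((s_j)_{j=0}^{\kappa}\) belongs to \(\mathcal K^{\ge,\mathrm e}_{q,\kappa,\alpha}\) if there is a complex \(q\times q\) matrix \(s_{\kappa+1}\) with \((s_j)_{j=0}^{\kappa+1}\in\mathcal K^{\ge}_{q,\kappa+1,\alpha}\). For \(\kappa=\infty\), it belongs to \(\mathcal K^{\ge,\mathrm e}_{q,\infty,\alpha}\) if \((s_j)_{j=0}^{m}\in\mathcal K^{\ge}_{q,m,\alpha}\) for all \(m\ge0\). *Right \(\alpha\)-Stieltjes parametrization.* Let \(L_0(s)=s_0\) and, for \(n\ge1\), \[ L_n(s)=s_{2n}-[s_n,\dots,s_{2n-1}]\,H_{n-1}(s)^\dagger\begin{bmatrix}s_n\\ \vdots\\ s_{2n-1}\end{bmatrix}. \] Then \(Q_{2k}=L_k(s)\) for all \(k\ge0\) with \(2k\le\kappa\), and \(Q_{2k+1}=L_k(s^{(\alpha)})\)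 for all \(k\ge0\) with \(2k+1\le\kappa\). *Transforms.* For a sequence \((u_j)\), the reciprocal sequence is given by \(u_0^\sharp=u_0^\dagger\) and \(u_j^\sharp=-u_0^\dagger\sum_{l=0}^{j-1}u_{j-l}u_l^\sharp\) for \(j\ge1\). For a sequence \((t_j)_{j=0}^{\tau}\) with \(\tau\ge1\), put \(u_0=t_0\) and \(u_j=-\alpha t_{j-1}+t_j\) for \(1\le j\le\tau\); the first \(\alpha\)-Schur–Stieltjes transform of \((t_j)_{j=0}^{\tau}\) is \(t_j^{[1,\alpha]}=-t_0\,u_{j+1}^\sharp\,t_0\) for \(0\le j\le\tau-1\). Finally, \(s_j^{[0,\alpha]}=s_j\) for \(0\le j\le\kappa\) and, for \(1\le k\le\kappa\), \((s_j^{[k,\alpha]})_{j=0}^{\kappa-k}\) is the first \(\alpha\)-Schur–Stieltjes transform of \((s_j^{[k-1,\alpha]})_{j=0}^{\kappa-k+1}\). -/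

import Mathlib

open scoped Matrix ComplexOrder

noncomputable section

namespace StieltjesSchur

/-! ### The Moore-Penrose inverse -/

/-- `X` satisfies the four Penrose equations for the complex matrix `A`. -/
structure IsMoorePenrose {m n : Type*} [Fintype m] [Fintype n]
    (A : Matrix m n ℂ) (X : Matrix n m ℂ) : Prop where
  mul_mul_left : A * X * A = A
  mul_mul_right : X * A * X = X
  left_hermitian : (A * X)ᴴ = A * X
  right_hermitian : (X * A)ᴴ = X * A

theorem exists_hermitian_pinv {n : Type*} [Fintype n] {B : Matrix n n ℂ} (hB : B.IsHermitian) :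
    ∃ P : Matrix n n ℂ, Pᴴ = P ∧ B * P * B = B ∧ P * B * P = P ∧ (P * B)ᴴ = P * B := by
  classical
  obtain ⟨U, d, hU, hBd⟩ : ∃ (U : Matrix n n ℂ) (d : n → ℝ), Uᴴ * U = 1 ∧
      B = U * Matrix.diagonal (fun i => (d i : ℂ)) * Uᴴ := by
    refine ⟨hB.eigenvectorUnitary, hB.eigenvalues, ?_, ?_⟩
    · exact Unitary.coe_star_mul_self hB.eigenvectorUnitary
    · have h := hB.spectral_theorem
      rw [Unitary.conjStarAlgAut_apply] at h
      exact h
  have key : ∀ D E : Matrix n n ℂ, (U * D * Uᴴ) * (U * E * Uᴴ) = U * (D * E) * Uᴴ := by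
    intro D E
    calc (U * D * Uᴴ) * (U * E * Uᴴ) = U * D * (Uᴴ * U) * E * Uᴴ := by
          simp only [Matrix.mul_assoc]
      _ = _ := by rw [hU, Matrix.mul_one]; simp only [Matrix.mul_assoc]
  refine ⟨U * Matrix.diagonal (fun i => ((d i)⁻¹ : ℂ)) * Uᴴ, ?_, ?_, ?_, ?_⟩
  · simp [Matrix.conjTranspose_mul, Matrix.mul_assoc, Matrix.diagonal_conjTranspose, Pi.star_def]
  · rw [hBd, key, key, Matrix.diagonal_mul_diagonal, Matrix.diagonal_mul_diagonal]
    congr 3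
    funext i
    by_cases h : d i = 0 <;> simp [h]
  · rw [hBd, key, key, Matrix.diagonal_mul_diagonal, Matrix.diagonal_mul_diagonal]
    congr 3
    funext i
    by_cases h : d i = 0 <;> simp [h]
  · rw [hBd, key, Matrix.diagonal_mul_diagonal]
    simp [Matrix.conjTranspose_mul, Matrix.mul_assoc, Matrix.diagonal_conjTranspose, Pi.star_def,
      mul_comm]

theorem exists_isMoorePenrose {m n : Type*} [Fintype m] [Fintype n] (A : Matrix m n ℂ) :
    ∃ X : Matrix n m ℂ, IsMoorePenrose A X := by
  classical
  obtain ⟨P, hP, h1, h2, h3⟩ :=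
    exists_hermitian_pinv (Matrix.isHermitian_conjTranspose_mul_self A)
  have hz : A * (1 - P * (Aᴴ * A)) = 0 := by
    rw [← Matrix.conjTranspose_mul_self_eq_zero, Matrix.conjTranspose_mul, Matrix.mul_assoc,
      ← Matrix.mul_assoc Aᴴ A, Matrix.mul_sub, Matrix.mul_one, ← Matrix.mul_assoc (Aᴴ * A) P, h1,
      sub_self, Matrix.mul_zero]
  refine ⟨P * Aᴴ, ?_, ?_, ?_, ?_⟩
  · rw [Matrix.mul_sub, Matrix.mul_one, sub_eq_zero] at hz
    rw [Matrix.mul_assoc, Matrix.mul_assoc P, ← hz]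
  · rw [← Matrix.mul_assoc, Matrix.mul_assoc P, h2]
  · simp [Matrix.conjTranspose_mul, hP, Matrix.mul_assoc]
  · rw [Matrix.mul_assoc, h3]

theorem IsMoorePenrose.unique {m n : Type*} [Fintype m] [Fintype n] {A : Matrix m n ℂ}
    {X Y : Matrix n m ℂ} (hX : IsMoorePenrose A X) (hY : IsMoorePenrose A Y) : X = Y := by
  have e1 : A * X = A * Y := by
    calc A * X = (A * X)ᴴ := hX.left_hermitian.symm
      _ = ((A * Y) * (A * X))ᴴ := by rw [← Matrix.mul_assoc, hY.mul_mul_left]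
      _ = (A * X) * (A * Y) := by
          rw [Matrix.conjTranspose_mul, hX.left_hermitian, hY.left_hermitian]
      _ = A * Y := by rw [← Matrix.mul_assoc, hX.mul_mul_left]
  have e2 : X * A = Y * A := by
    calc X * A = (X * A)ᴴ := hX.right_hermitian.symm
      _ = ((X * A) * (Y * A))ᴴ := by
          rw [Matrix.mul_assoc X, ← Matrix.mul_assoc A, hY.mul_mul_left]
      _ = (Y * A) * (X * A) := by
          rw [Matrix.conjTranspose_mul, hX.right_hermitian, hY.right_hermitian]
      _ = Y * A := by rw [Matrix.mul_assoc Y, ← Matrix.mul_assoc A, hX.mul_mul_left]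
  calc X = X * (A * X) := by rw [← Matrix.mul_assoc, hX.mul_mul_right]
    _ = Y * A * Y := by rw [e1, ← Matrix.mul_assoc, e2]
    _ = Y := hY.mul_mul_right

/-- The Moore-Penrose inverse of a complex matrix: the unique solution of the Penrose equations. -/
def moorePenrose {m n : Type*} [Fintype m] [Fintype n] (A : Matrix m n ℂ) : Matrix n m ℂ :=
  Classical.choose (exists_isMoorePenrose A)

theorem moorePenrose_spec {m n : Type*} [Fintype m] [Fintype n] (A : Matrix m n ℂ) :
    IsMoorePenrose A (moorePenrose A) :=
  Classical.choose_spec (exists_isMoorePenrose A)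

/-! ### Sequences of matrices and block Hankel matrices

A sequence `(s_j)_{j=0}^κ` with `κ ∈ ℕ ∪ {∞}` is represented by a function `s` on `ℕ` together
with `κ : ℕ∞`; the values `s j` with `j > κ` are irrelevant: each notion below that is attached
to `κ` refers to `s j` for `j ≤ κ` only. -/

/-- A sequence of complex `p × q` matrices. -/
abbrev MatSeq (p q : ℕ) : Type := ℕ → Matrix (Fin p) (Fin q) ℂ

/-- The block Hankel matrix `H_n = [s_{j+k}]_{j,k=0}^n`. -/
def blockHankel {p q : ℕ} (s : MatSeq p q) (n : ℕ) :
    Matrix (Fin (n + 1) × Fin p) (Fin (n + 1) × Fin q) ℂ :=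
  Matrix.of fun a b => s (a.1 + b.1) a.2 b.2

/-- The block column `col (s_l, s_{l+1}, …, s_{l+c-1})` with `c` blocks. -/
def blockCol {p q : ℕ} (s : MatSeq p q) (l c : ℕ) : Matrix (Fin c × Fin p) (Fin q) ℂ :=
  Matrix.of fun a b => s (l + a.1) a.2 b

/-- The block row `[s_l, s_{l+1}, …, s_{l+c-1}]` with `c` blocks. -/
def blockRow {p q : ℕ} (s : MatSeq p q) (l c : ℕ) : Matrix (Fin p) (Fin c × Fin q) ℂ :=
  Matrix.of fun a b => s (l + b.1) a b.2

/-- `L_0 = s_0` and `L_n = s_{2n} - [s_n, …, s_{2n-1}] (H_{n-1})^† col (s_n, …, s_{2n-1})`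
for `n ≥ 1`. -/
def schurL {p q : ℕ} (s : MatSeq p q) : ℕ → Matrix (Fin p) (Fin q) ℂ
  | 0 => s 0
  | n + 1 => s (2 * (n + 1)) -
      blockRow s (n + 1) (n + 1) * moorePenrose (blockHankel s n) * blockCol s (n + 1) (n + 1)

/-- The sequence `-α s_j + s_{j+1}`, which has one term less than `s`. -/
def rightShift {p q : ℕ} (α : ℂ) (s : MatSeq p q) : MatSeq p q :=
  fun j => -(α • s j) + s (j + 1)

/-! ### `α`-Stieltjes non-negative definite (extendable) sequences -/

/-- `(s_j)_{j=0}^m` is `α`-Stieltjes non-negative definite, for finite `m`. -/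
def IsStieltjesNonnegFin {q : ℕ} (α : ℝ) (m : ℕ) (s : MatSeq q q) : Prop :=
  (m = 0 → (blockHankel s 0).PosSemidef) ∧
  (∀ n : ℕ, m = 2 * (n + 1) →
    (blockHankel s (n + 1)).PosSemidef ∧ (blockHankel (rightShift (α : ℂ) s) n).PosSemidef) ∧
  (∀ n : ℕ, m = 2 * n + 1 →
    (blockHankel s n).PosSemidef ∧ (blockHankel (rightShift (α : ℂ) s) n).PosSemidef)

/-- `(s_j)_{j=0}^κ` is `α`-Stieltjes non-negative definite extendable: for finite `κ` it can be
prolonged by one further matrix to an `α`-Stieltjes non-negative definite sequence; for `κ = ∞`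
each section `(s_j)_{j=0}^m` is `α`-Stieltjes non-negative definite. -/
def IsStieltjesNonnegExt {q : ℕ} (α : ℝ) (κ : ℕ∞) (s : MatSeq q q) : Prop :=
  (∀ m : ℕ, κ = (m : ℕ∞) →
    ∃ t : MatSeq q q, (∀ j ≤ m, t j = s j) ∧ IsStieltjesNonnegFin α (m + 1) t) ∧
  (κ = ⊤ → ∀ m : ℕ, IsStieltjesNonnegFin α m s)

/-! ### The right `α`-Stieltjes parametrization -/

/-- `(Q_j)_{j=0}^κ` is the right `α`-Stieltjes parametrization of `(s_j)_{j=0}^κ`. -/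
def IsRightStieltjesParam {p q : ℕ} (α : ℂ) (κ : ℕ∞) (s Q : MatSeq p q) : Prop :=
  (∀ k : ℕ, ((2 * k : ℕ) : ℕ∞) ≤ κ → Q (2 * k) = schurL s k) ∧
  (∀ k : ℕ, ((2 * k + 1 : ℕ) : ℕ∞) ≤ κ → Q (2 * k + 1) = schurL (rightShift α s) k)

/-! ### The `α`-Schur-Stieltjes transforms -/

/-- The reciprocal sequence: `s_0^♯ = s_0^†` and
`s_j^♯ = - s_0^† ∑_{l=0}^{j-1} s_{j-l} s_l^♯` for `j ≥ 1`. -/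
def reciprocal {p q : ℕ} (s : MatSeq p q) : ℕ → Matrix (Fin q) (Fin p) ℂ
  | 0 => moorePenrose (s 0)
  | j + 1 => -(moorePenrose (s 0) * ∑ l : Fin (j + 1), s (j + 1 - l) * reciprocal s l)
termination_by j => j
decreasing_by exact l.isLt

/-- The `[+, α]`-transform: `-α s_{j-1} + s_j` with `s_{-1} = 0`. -/
def plusTransform {p q : ℕ} (α : ℂ) (s : MatSeq p q) : MatSeq p q
  | 0 => s 0
  | j + 1 => -(α • s j) + s (j + 1)

/-- The first transform `s_j^{[1,α]} = s_0 (-u_{j+1}^♯) s_0`, where `u` is the `[+, α]`-transform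
of `s`; it has one term less than `s`. -/
def schurTransform {p q : ℕ} (α : ℂ) (s : MatSeq p q) : MatSeq p q :=
  fun j => s 0 * (-(reciprocal (plusTransform α s) (j + 1))) * s 0

/-- The `k`-th transform `(s_j^{[k,α]})_{j=0}^{κ-k}`. -/
def iterSchurTransform {p q : ℕ} (α : ℂ) (s : MatSeq p q) : ℕ → MatSeq p q
  | 0 => s
  | k + 1 => schurTransform α (iterSchurTransform α s k)

end StieltjesSchur

end

/-! The transform shifts the parametrization by one place. Let `V` be the first transform of `t`,
let `u` be the `[+, α]`-transform of `t`, and suppose that all `t j` are Hermitian with range inside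
that of `t 0` (`IsDominated`). Two block congruences hold. The Hankel matrix of `rightShift α t` is
`Rᴴ H_n(V) R`, where `R` is unit upper triangular block Toeplitz with off-diagonal blocks `(t 0)^† u
j`. The Hankel matrix `H_{n+1}(t)` is `R'ᴴ diag(t 0, H_n(rightShift α V)) R'`, where `R'` is built
likewise from `(t 0)^† t j`. These are `IsDominated.blockHankel_rightShift` and
`IsDominated.blockHankel_succ`.

Such congruences preserve positive semidefiniteness and the Schur complement at the last diagonal
block, and that Schur complement is `schurL`. Hence `V` is again non-negative, with one term less,
and `L_n(V) = L_n(rightShift α t)`, `L_n(rightShift α V) = L_{n+1}(t)`. Induction on the number of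
transforms then gives the theorem.

The congruences come from convolution identities for the reciprocal sequence, valid in any ring
(`transform_convolution`). Extendability supplies the range condition: one further non-negative term
forces the kernel of `s 0` into the kernels of the given `s j` (`HankelNonneg.mul_eq_zero`). The
further term itself is brought under control by compression to the range of `s 0`. -/

open scoped Matrix ComplexOrder

noncomputable section

namespace StieltjesSchur

/-! ### Convolution identities in a ring -/

section Convolution

open Finset

variable {R : Type*} [Ring R]

/-- The product of a lower triangular Toeplitz matrix, a matrix `D`, and an upper triangular
Toeplitz matrix, entrywise. -/
def toeplitzConj (l : ℕ → R) (D : ℕ → ℕ → R) (r : ℕ → R) (i j : ℕ) : R :=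
  ∑ a ∈ range (i + 1), ∑ b ∈ range (j + 1), l (i - a) * D a b * r (j - b)

/-- The sequence `x` with its first term replaced by `1`. -/
def monic (x : ℕ → R) : ℕ → R
  | 0 => 1
  | j + 1 => x (j + 1)

/-- The kernel of the block diagonal matrix with blocks `c` and `D`. -/
def borderKernel (c : R) (D : ℕ → ℕ → R) : ℕ → ℕ → R
  | 0, 0 => c
  | _ + 1, 0 => 0
  | 0, _ + 1 => 0
  | a + 1, b + 1 => D a b

/-- A Hankel kernel depends on `a + b` only, so moving one step along an antidiagonal changes the
double sum by boundary terms alone. With this recursion the first row and the first column determine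
every entry. -/
theorem toeplitzConj_succ_left (l v r : ℕ → R) (i j : ℕ) :
    toeplitzConj l (fun a b => v (a + b)) r (i + 1) j +
        (∑ a ∈ range (i + 1), l (i - a) * v a) * r (j + 1) =
      toeplitzConj l (fun a b => v (a + b)) r i (j + 1) +
        l (i + 1) * ∑ b ∈ range (j + 1), v b * r (j - b) := by
  have h : ∀ i j, toeplitzConj l (fun a b => v (a + b)) r i j =
      ∑ b ∈ range (j + 1), (∑ a ∈ range (i + 1), l (i - a) * v (a + b)) * r (j - b) := by
    intro i j
    simp only [toeplitzConj, sum_mul]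
    exact sum_comm
  rw [h, h, sum_range_succ' _ (j + 1)]
  simp only [Nat.succ_sub_succ, Nat.sub_zero, add_zero]
  have h2 : ∀ m, ∑ a ∈ range (i + 1 + 1), l (i + 1 - a) * v (a + m) =
      (∑ a ∈ range (i + 1), l (i - a) * v (a + (m + 1))) + l (i + 1) * v m := by
    intro m
    rw [sum_range_succ']
    simp only [Nat.succ_sub_succ, Nat.sub_zero, zero_add]
    congr 1
    exact sum_congr rfl fun a _ => by rw [add_right_comm, add_assoc]
  simp only [h2, add_mul, sum_add_distrib, mul_sum, mul_assoc]
  abel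

theorem toeplitzConj_zero_left (l v r : ℕ → R) (hl : l 0 = 1) (j : ℕ) :
    toeplitzConj l (fun a b => v (a + b)) r 0 j = ∑ b ∈ range (j + 1), v b * r (j - b) := by
  simp [toeplitzConj, hl]

theorem toeplitzConj_borderKernel_succ (c : R) (l r : ℕ → R) (D : ℕ → ℕ → R) (i j : ℕ) :
    toeplitzConj l (borderKernel c D) r (i + 1) (j + 1) =
      toeplitzConj l D r i j + l (i + 1) * c * r (j + 1) := by
  unfold toeplitzConj
  rw [sum_range_succ']
  simp only [sum_range_succ' _ (j + 1)]
  simp [borderKernel]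

theorem toeplitzConj_borderKernel_zero_left (c : R) (l r : ℕ → R) (D : ℕ → ℕ → R) (j : ℕ) :
    toeplitzConj l (borderKernel c D) r 0 j = l 0 * c * r j := by
  unfold toeplitzConj
  simp only [sum_range_succ' _ j]
  simp [borderKernel]

theorem toeplitzConj_borderKernel_zero_right (c : R) (l r : ℕ → R) (D : ℕ → ℕ → R) (i : ℕ) :
    toeplitzConj l (borderKernel c D) r i 0 = l i * c * r 0 := by
  unfold toeplitzConj
  rw [sum_range_succ']
  simp [borderKernel]

theorem coeff_mk_mul_mk (x y : ℕ → R) (n : ℕ) :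
    PowerSeries.coeff n (PowerSeries.mk x * PowerSeries.mk y) =
      ∑ l ∈ range (n + 1), x l * y (n - l) := by
  rw [PowerSeries.coeff_mul,
    Finset.Nat.sum_antidiagonal_eq_sum_range_succ
      (fun i j => PowerSeries.coeff i (PowerSeries.mk x) * PowerSeries.coeff j (PowerSeries.mk y))]
  simp [PowerSeries.coeff_mk]

theorem sum_mul_flip (x y : ℕ → R) (n : ℕ) :
    ∑ l ∈ range (n + 1), x l * y (n - l) = ∑ l ∈ range (n + 1), x (n - l) * y l := by
  rw [← sum_range_reflect]
  refine sum_congr rfl fun a ha => ?_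
  have : a ≤ n := Nat.lt_succ_iff.mp (mem_range.mp ha)
  rw [show n + 1 - 1 - a = n - a by omega, show n - (n - a) = a by omega]

/-- A power series whose constant coefficient `u₀` has inner inverse `e` is left cancellable on
the range of `e u₀`. -/
theorem eq_zero_of_mk_mul_eq_zero {u : ℕ → R} {e : R} {Z : PowerSeries R}
    (hZ : PowerSeries.C (e * u 0) * Z = Z) (h : PowerSeries.mk u * Z = 0) : Z = 0 := by
  ext n
  induction n using Nat.strong_induction_on with
  | _ n ih =>
    have hn := congrArg (PowerSeries.coeff n) h
    rw [← show PowerSeries.mk (fun n => PowerSeries.coeff n Z) = Z by ext; simp,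
      coeff_mk_mul_mk, sum_mul_flip u (fun n => PowerSeries.coeff n Z), sum_range_succ, sum_eq_zero,
      zero_add, Nat.sub_self] at hn
    · rw [← hZ, PowerSeries.coeff_C_mul, mul_assoc, hn]
      simp
    · intro a ha
      rw [ih a (mem_range.mp ha)]
      simp

/-! ### The reciprocal sequence as a generalized inverse power series. -/

section Reciprocal

variable {u y : ℕ → R} {e : R}

open PowerSeries in
/-- The reciprocal sequence is a two-sided generalized inverse with respect to convolution. -/
theorem mk_mul_reciprocal (h1 : ∀ j, u 0 * e * u j = u j) (h2 : ∀ j, u j * e * u 0 = u j)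
    (h3 : e * u 0 * e = e) (hy0 : y 0 = e)
    (hy : ∀ j, y (j + 1) = -(e * ∑ l : Fin (j + 1), u (j + 1 - l) * y l)) :
    PowerSeries.mk u * PowerSeries.mk y = C (u 0 * e) ∧
      PowerSeries.mk y * PowerSeries.mk u = C (e * u 0) := by
  have hUY : PowerSeries.mk u * PowerSeries.mk y = C (u 0 * e) := by
    ext n
    rw [coeff_mk_mul_mk, sum_mul_flip]
    cases n with
    | zero => simp [hy0]
    | succ n =>
      rw [sum_range_succ, hy, Fin.sum_univ_eq_sum_range (fun l => u (n + 1 - l) * y l),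
        Nat.sub_self, mul_neg, ← mul_assoc, mul_sum, coeff_C, if_neg (Nat.succ_ne_zero n),
        ← sub_eq_add_neg, sub_eq_zero]
      refine sum_congr rfl fun l _ => ?_
      rw [← mul_assoc, h1]
  refine ⟨hUY, ?_⟩
  have hPY : C (e * u 0) * PowerSeries.mk y = PowerSeries.mk y := by
    ext n
    rw [coeff_C_mul, coeff_mk]
    cases n with
    | zero => rw [hy0, h3]
    | succ n => rw [hy, mul_neg, ← mul_assoc, h3]
  have hPU : C (u 0 * e) * PowerSeries.mk u = PowerSeries.mk u := by
    ext n
    rw [coeff_C_mul, coeff_mk, h1]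
  have hUP : PowerSeries.mk u * C (e * u 0) = PowerSeries.mk u := by
    ext n
    rw [coeff_mul_C, coeff_mk, ← mul_assoc, h2]
  -- The difference of the two sides is annihilated by `mk u` on the left and is fixed by the
  -- projector `e * u 0`, so cancellation applies.
  rw [← sub_eq_zero]
  refine eq_zero_of_mk_mul_eq_zero (u := u) (e := e) ?_ ?_
  · rw [mul_sub, ← mul_assoc, hPY, ← map_mul, ← mul_assoc, h3]
  · rw [mul_sub, ← mul_assoc, hUY, hPU, hUP, sub_self]

-- Write `U`, `Y`, `V` for the series of `u`, `y` and the transform. By definition `X V = u₀ (e - Y)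
-- u₀`, so `X V e U = U - u₀ Y U = U - u₀`, and symmetrically on the other side. Comparing
-- coefficients gives both sums.
open PowerSeries in
theorem transform_convolution (h1 : ∀ j, u 0 * e * u j = u j) (h2 : ∀ j, u j * e * u 0 = u j)
    (h3 : e * u 0 * e = e) (hy0 : y 0 = e)
    (hy : ∀ j, y (j + 1) = -(e * ∑ l : Fin (j + 1), u (j + 1 - l) * y l)) (j : ℕ) :
    ∑ b ∈ range (j + 1), (u 0 * -y (b + 1) * u 0) * (e * u (j - b)) = u (j + 1) ∧
    ∑ a ∈ range (j + 1), (u (j - a) * e) * (u 0 * -y (a + 1) * u 0) = u (j + 1) := by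
  obtain ⟨hUY, hYU⟩ := mk_mul_reciprocal h1 h2 h3 hy0 hy
  set V : PowerSeries R := PowerSeries.mk fun b => u 0 * -y (b + 1) * u 0 with hV
  have hXV : X * V = C (u 0) * (C e - PowerSeries.mk y) * C (u 0) := by
    ext n
    rw [coeff_mul_C, coeff_C_mul]
    cases n with
    | zero => simp [hy0]
    | succ n => simp [coeff_succ_X_mul, hV]
  have hVX : V * X = C (u 0) * (C e - PowerSeries.mk y) * C (u 0) := by
    rw [← hXV]
    exact (commute_X V).eq
  have hPU : C (u 0 * e) * PowerSeries.mk u = PowerSeries.mk u := by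
    ext n
    rw [coeff_C_mul, coeff_mk, h1]
  have hUP : PowerSeries.mk u * C (e * u 0) = PowerSeries.mk u := by
    ext n
    rw [coeff_mul_C, coeff_mk, ← mul_assoc, h2]
  have hC : ∀ a b : R, (C (a * b) : PowerSeries R) = C a * C b := fun a b => map_mul _ _ _
  have hl : X * (V * (C e * PowerSeries.mk u)) = PowerSeries.mk u - C (u 0) := by
    calc X * (V * (C e * PowerSeries.mk u)) = X * V * (C e * PowerSeries.mk u) := by rw [mul_assoc]
      _ = C (u 0) * (C e - PowerSeries.mk y) * (C (u 0 * e) * PowerSeries.mk u) := by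
          rw [hXV, hC]; simp only [mul_assoc]
      _ = PowerSeries.mk u - C (u 0) * (PowerSeries.mk y * PowerSeries.mk u) := by
          rw [hPU, mul_sub, sub_mul, ← hC, hPU, mul_assoc]
      _ = PowerSeries.mk u - C (u 0) := by rw [hYU, ← hC, ← mul_assoc, h1]
  have hr : PowerSeries.mk u * C e * V * X = PowerSeries.mk u - C (u 0) := by
    calc PowerSeries.mk u * C e * V * X = PowerSeries.mk u * C e * (V * X) := by rw [mul_assoc]
      _ = PowerSeries.mk u * C (e * u 0) * (C e - PowerSeries.mk y) * C (u 0) := by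
          rw [hVX, hC]; simp only [mul_assoc]
      _ = PowerSeries.mk u - (PowerSeries.mk u * PowerSeries.mk y) * C (u 0) := by
          rw [hUP, mul_sub, sub_mul, mul_assoc, ← hC, hUP]
      _ = PowerSeries.mk u - C (u 0) := by rw [hUY, ← hC, h1]
  have eu : C e * PowerSeries.mk u = PowerSeries.mk fun j => e * u j := by ext; simp
  have ue : PowerSeries.mk u * C e = PowerSeries.mk fun j => u j * e := by ext; simp
  constructor
  · have := congrArg (coeff (j + 1)) hl
    rwa [coeff_succ_X_mul, eu, coeff_mk_mul_mk, map_sub, coeff_mk, coeff_C,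
      if_neg (Nat.succ_ne_zero j), sub_zero] at this
  · have := congrArg (coeff (j + 1)) hr
    rwa [coeff_succ_mul_X, ue, coeff_mk_mul_mk, map_sub, coeff_mk, coeff_C,
      if_neg (Nat.succ_ne_zero j), sub_zero,
      sum_mul_flip (fun j => u j * e) (fun b => u 0 * -y (b + 1) * u 0)] at this

end Reciprocal

/-! ### Entrywise congruences between Hankel kernels of a sequence and of its transform. -/

section Congruence

variable {u v : ℕ → R} {e : R}

/-- The natural Toeplitz factor has the projector `e * u 0` on its diagonal and is singular in
general. Since `v` absorbs that projector, the diagonal may be replaced by `1`, which makes the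
factor invertible. -/
theorem sum_mul_monic {x v : ℕ → R} (j : ℕ) (h : v j * x 0 = v j) :
    ∑ b ∈ range (j + 1), v b * monic x (j - b) = ∑ b ∈ range (j + 1), v b * x (j - b) := by
  rw [sum_range_succ, sum_range_succ, Nat.sub_self, h]
  congr 1
  · refine sum_congr rfl fun b hb => ?_
    obtain ⟨k, hk⟩ := Nat.exists_eq_succ_of_ne_zero (Nat.sub_ne_zero_of_lt (mem_range.mp hb))
    rw [hk]; rfl
  · exact mul_one _

theorem sum_monic_mul {x v : ℕ → R} (j : ℕ) (h : x 0 * v j = v j) :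
    ∑ b ∈ range (j + 1), monic x (j - b) * v b = ∑ b ∈ range (j + 1), x (j - b) * v b := by
  rw [sum_range_succ, sum_range_succ, Nat.sub_self, h]
  congr 1
  · refine sum_congr rfl fun b hb => ?_
    obtain ⟨k, hk⟩ := Nat.exists_eq_succ_of_ne_zero (Nat.sub_ne_zero_of_lt (mem_range.mp hb))
    rw [hk]; rfl
  · exact one_mul _

/-- The convolution identities evaluate the first row and both boundary sums. In the recursion the
two boundary terms are each `u (i+1) * e * u (j+1)`, so they cancel and the result depends on `i +
j` only. -/
theorem toeplitzConj_transform (hv1 : ∀ j, v j * (e * u 0) = v j)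
    (hv2 : ∀ j, u 0 * e * v j = v j)
    (hl : ∀ j, ∑ b ∈ range (j + 1), v b * (e * u (j - b)) = u (j + 1))
    (hr : ∀ j, ∑ a ∈ range (j + 1), (u (j - a) * e) * v a = u (j + 1)) (i j : ℕ) :
    toeplitzConj (monic fun j => u j * e) (fun a b => v (a + b)) (monic fun j => e * u j) i j =
      u (i + j + 1) := by
  induction i generalizing j with
  | zero =>
    rw [toeplitzConj_zero_left _ _ _ rfl, sum_mul_monic (x := fun j => e * u j) _ (hv1 _), hl,
      zero_add]
  | succ i ih =>
    have := toeplitzConj_succ_left (monic fun j => u j * e) v (monic fun j => e * u j) i j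
    rw [sum_mul_monic (x := fun j => e * u j) _ (hv1 _), hl,
      sum_monic_mul (x := fun j => u j * e) _ (hv2 _), hr, ih] at this
    simp only [monic, mul_assoc, add_left_inj] at this
    rw [this]
    congr 1
    omega

variable {S : Type*} [CommRing S] [Algebra S R] {α : S} {t : ℕ → R}

/-- As power series `u = (1 - αX) t`, which turns convolution against `u` into a difference of
convolutions against `t`. -/
theorem sum_transform_mul (hu0 : u 0 = t 0) (hu : ∀ j, u (j + 1) = -(α • t j) + t (j + 1))
    (hl : ∀ j, ∑ b ∈ range (j + 1), v b * (e * u (j - b)) = u (j + 1)) (j : ℕ) :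
    ∑ b ∈ range (j + 2), v b * (e * t (j + 1 - b)) -
      α • ∑ b ∈ range (j + 1), v b * (e * t (j - b)) = u (j + 2) := by
  rw [← hl (j + 1), sum_range_succ, sum_range_succ _ (j + 1), Nat.sub_self, hu0, add_sub_right_comm]
  congr 1
  rw [smul_sum, ← sum_sub_distrib]
  refine sum_congr rfl fun b hb => ?_
  have hb : b ≤ j := Nat.lt_succ_iff.mp (mem_range.mp hb)
  rw [show j + 1 - b = j - b + 1 by omega, hu]
  simp only [mul_add, mul_neg, mul_smul_comm]
  abel

theorem sum_mul_transform (hu0 : u 0 = t 0) (hu : ∀ j, u (j + 1) = -(α • t j) + t (j + 1))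
    (hr : ∀ j, ∑ a ∈ range (j + 1), (u (j - a) * e) * v a = u (j + 1)) (j : ℕ) :
    ∑ a ∈ range (j + 2), (t (j + 1 - a) * e) * v a -
      α • ∑ a ∈ range (j + 1), (t (j - a) * e) * v a = u (j + 2) := by
  rw [← hr (j + 1), sum_range_succ, sum_range_succ _ (j + 1), Nat.sub_self, hu0, add_sub_right_comm]
  congr 1
  rw [smul_sum, ← sum_sub_distrib]
  refine sum_congr rfl fun b hb => ?_
  have hb : b ≤ j := Nat.lt_succ_iff.mp (mem_range.mp hb)
  rw [show j + 1 - b = j - b + 1 by omega, hu]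
  simp only [add_mul, neg_mul, smul_mul_assoc]
  abel

theorem sum_shift_mul (hu0 : u 0 = t 0) (hu : ∀ j, u (j + 1) = -(α • t j) + t (j + 1))
    (ht1 : ∀ j, t 0 * e * t j = t j) (hv1 : ∀ j, v j * (e * t 0) = v j)
    (hl : ∀ j, ∑ b ∈ range (j + 1), v b * (e * u (j - b)) = u (j + 1)) (j : ℕ) :
    ∑ b ∈ range (j + 1), (-(α • v b) + v (b + 1)) * monic (fun j => e * t j) (j - b) =
      t (j + 2) - t 1 * e * t (j + 1) := by
  have hv0 : v 0 = -(α • t 0) + t 1 := by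
    have := hl 0
    rw [← hu 0, ← this]
    simp [hu0, hv1]
  have := sum_transform_mul hu0 hu hl j
  rw [sum_range_succ', hu] at this
  rw [sum_mul_monic (x := fun j => e * t j) (v := fun b => -(α • v b) + v (b + 1)) _
    (by rw [add_mul, neg_mul, smul_mul_assoc, hv1, hv1])]
  simp only [add_mul, neg_mul, smul_mul_assoc, sum_add_distrib, sum_neg_distrib, ← smul_sum,
    Nat.succ_sub_succ, Nat.sub_zero] at this ⊢
  -- The term with `b = 0` splits by `v 0 = u 1`; it produces the correction `t 1 * e * t (j + 1)`.
  rw [hv0, add_mul, neg_mul, smul_mul_assoc, ← mul_assoc, ht1, ← mul_assoc] at this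
  rw [← sub_eq_zero] at this ⊢
  rw [← this]
  abel

theorem sum_mul_shift (hu0 : u 0 = t 0) (hu : ∀ j, u (j + 1) = -(α • t j) + t (j + 1))
    (ht2 : ∀ j, t j * e * t 0 = t j) (hv2 : ∀ j, t 0 * e * v j = v j)
    (hr : ∀ j, ∑ a ∈ range (j + 1), (u (j - a) * e) * v a = u (j + 1)) (j : ℕ) :
    ∑ a ∈ range (j + 1), monic (fun j => t j * e) (j - a) * (-(α • v a) + v (a + 1)) =
      t (j + 2) - t (j + 1) * e * t 1 := by
  have hv0 : v 0 = -(α • t 0) + t 1 := by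
    have := hr 0
    rw [← hu 0, ← this]
    simp [hu0, hv2]
  have := sum_mul_transform hu0 hu hr j
  rw [sum_range_succ', hu] at this
  rw [sum_monic_mul (x := fun j => t j * e) (v := fun b => -(α • v b) + v (b + 1)) _
    (by rw [mul_add, mul_neg, mul_smul_comm, hv2, hv2])]
  simp only [mul_add, mul_neg, mul_smul_comm, sum_add_distrib, sum_neg_distrib, ← smul_sum,
    Nat.succ_sub_succ, Nat.sub_zero] at this ⊢
  rw [hv0, mul_add, mul_neg, mul_smul_comm, ht2] at this
  rw [← sub_eq_zero] at this ⊢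
  rw [← this]
  abel

/-- The right side is the generalized Schur complement of the leading block `t 0` in the Hankel
kernel of `t`. Here the boundary terms do not cancel; their difference is exactly what moves the
subtracted product along the antidiagonal. -/
theorem toeplitzConj_shift_transform (hu0 : u 0 = t 0)
    (hu : ∀ j, u (j + 1) = -(α • t j) + t (j + 1))
    (ht1 : ∀ j, t 0 * e * t j = t j) (ht2 : ∀ j, t j * e * t 0 = t j)
    (hv1 : ∀ j, v j * (e * t 0) = v j) (hv2 : ∀ j, t 0 * e * v j = v j)
    (hl : ∀ j, ∑ b ∈ range (j + 1), v b * (e * u (j - b)) = u (j + 1))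
    (hr : ∀ j, ∑ a ∈ range (j + 1), (u (j - a) * e) * v a = u (j + 1)) (i j : ℕ) :
    toeplitzConj (monic fun j => t j * e) (fun a b => -(α • v (a + b)) + v (a + b + 1))
      (monic fun j => e * t j) i j = t (i + j + 2) - t (i + 1) * e * t (j + 1) := by
  induction i generalizing j with
  | zero =>
    rw [toeplitzConj_zero_left _ (fun b => -(α • v b) + v (b + 1)) _ rfl,
      sum_shift_mul hu0 hu ht1 hv1 hl, zero_add, zero_add]
  | succ i ih =>
    have := toeplitzConj_succ_left (monic fun j => t j * e) (fun b => -(α • v b) + v (b + 1))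
      (monic fun j => e * t j) i j
    rw [sum_shift_mul hu0 hu ht1 hv1 hl, sum_mul_shift hu0 hu ht2 hv2 hr, ih,
      ← eq_sub_iff_add_eq] at this
    rw [this, show i + 1 + j + 2 = i + (j + 1) + 2 by omega]
    simp only [monic, mul_sub, sub_mul, mul_assoc]
    abel

/-- Bordering by `t 0` restores the subtracted product, because `t (i+1) * e * t 0 * e * t (j+1) = t
(i+1) * e * t (j+1)`. -/
theorem toeplitzConj_borderKernel_transform (hu0 : u 0 = t 0)
    (hu : ∀ j, u (j + 1) = -(α • t j) + t (j + 1))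
    (ht1 : ∀ j, t 0 * e * t j = t j) (ht2 : ∀ j, t j * e * t 0 = t j)
    (hv1 : ∀ j, v j * (e * t 0) = v j) (hv2 : ∀ j, t 0 * e * v j = v j)
    (hl : ∀ j, ∑ b ∈ range (j + 1), v b * (e * u (j - b)) = u (j + 1))
    (hr : ∀ j, ∑ a ∈ range (j + 1), (u (j - a) * e) * v a = u (j + 1)) (i j : ℕ) :
    toeplitzConj (monic fun j => t j * e)
      (borderKernel (t 0) fun a b => -(α • v (a + b)) + v (a + b + 1))
      (monic fun j => e * t j) i j = t (i + j) := by
  have m1 : ∀ j, t 0 * monic (fun j => e * t j) j = t j := by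
    rintro (_ | j)
    · exact mul_one _
    · rw [monic, ← mul_assoc, ht1]
  have m2 : ∀ j, monic (fun j => t j * e) j * t 0 = t j := by
    rintro (_ | j)
    · exact one_mul _
    · rw [monic, ht2]
  rcases i with _ | i
  · rw [toeplitzConj_borderKernel_zero_left, mul_assoc, m1, zero_add]
    exact one_mul _
  · rcases j with _ | j
    · rw [toeplitzConj_borderKernel_zero_right, m2]
      exact mul_one _
    · rw [toeplitzConj_borderKernel_succ, m2,
        toeplitzConj_shift_transform hu0 hu ht1 ht2 hv1 hv2 hl hr, monic,
        show i + 1 + (j + 1) = i + j + 2 by omega, ← mul_assoc, sub_add_cancel]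

end Congruence

end Convolution

/-! ### Block matrices -/

section BlockMatrix

open Finset

/-- The `m × n` block matrix with blocks `D i j`. -/
def blockMatrix {p q : ℕ} (m n : ℕ) (D : ℕ → ℕ → Matrix (Fin p) (Fin q) ℂ) :
    Matrix (Fin m × Fin p) (Fin n × Fin q) ℂ :=
  Matrix.of fun a b => D a.1 b.1 a.2 b.2

/-- The upper triangular block Toeplitz matrix built from the sequence `r`. -/
def blockToeplitz {q : ℕ} (r : MatSeq q q) (n : ℕ) :
    Matrix (Fin n × Fin q) (Fin n × Fin q) ℂ :=
  blockMatrix n n fun a b => if a ≤ b then r (b - a) else 0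

theorem blockHankel_eq_blockMatrix {p q : ℕ} (s : MatSeq p q) (n : ℕ) :
    blockHankel s n = blockMatrix (n + 1) (n + 1) fun i j => s (i + j) := rfl

theorem blockMatrix_congr {p q m n : ℕ} {D E : ℕ → ℕ → Matrix (Fin p) (Fin q) ℂ}
    (h : ∀ i < m, ∀ j < n, D i j = E i j) : blockMatrix m n D = blockMatrix m n E := by
  ext a b
  simp only [blockMatrix, Matrix.of_apply]
  rw [h _ a.1.isLt _ b.1.isLt]

theorem blockMatrix_mul {p q r m k n : ℕ} (D : ℕ → ℕ → Matrix (Fin p) (Fin q) ℂ)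
    (E : ℕ → ℕ → Matrix (Fin q) (Fin r) ℂ) :
    blockMatrix m k D * blockMatrix k n E =
      blockMatrix m n fun i j => ∑ a ∈ range k, D i a * E a j := by
  ext x y
  simp only [blockMatrix, Matrix.mul_apply, Matrix.of_apply, Matrix.sum_apply,
    Fintype.sum_prod_type]
  exact Fin.sum_univ_eq_sum_range (fun a => ∑ z, D x.1 a x.2 z * E a y.1 z y.2) k

theorem blockMatrix_conjTranspose {p q m n : ℕ} (D : ℕ → ℕ → Matrix (Fin p) (Fin q) ℂ) :
    (blockMatrix m n D)ᴴ = blockMatrix n m fun i j => (D j i)ᴴ := rfl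

theorem sum_range_ite_le {M : Type*} [AddCommMonoid M] {i n : ℕ} (hi : i < n) (f : ℕ → M) :
    ∑ a ∈ range n, (if a ≤ i then f a else 0) = ∑ a ∈ range (i + 1), f a := by
  rw [← sum_filter]
  congr 1
  ext a
  simp only [mem_filter, mem_range]
  omega

theorem blockToeplitz_conj {q : ℕ} {l r : MatSeq q q} {n : ℕ} (h : ∀ j < n, l j = (r j)ᴴ)
    (D : ℕ → ℕ → Matrix (Fin q) (Fin q) ℂ) :
    (blockToeplitz r n)ᴴ * blockMatrix n n D * blockToeplitz r n =
      blockMatrix n n (toeplitzConj l D r) := by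
  rw [blockToeplitz, blockMatrix_conjTranspose, blockMatrix_mul, blockMatrix_mul]
  refine blockMatrix_congr fun i hi j hj => ?_
  simp only [mul_ite, mul_zero]
  rw [sum_range_ite_le hj, toeplitzConj, sum_comm]
  refine sum_congr rfl fun b _ => ?_
  rw [← sum_mul]
  congr 1
  rw [← sum_range_ite_le hi]
  refine sum_congr rfl fun a _ => ?_
  split_ifs with ha
  · rw [h _ (by omega)]
  · simp

theorem isUnit_blockToeplitz {q : ℕ} {r : MatSeq q q} (hr : r 0 = 1) (n : ℕ) :
    IsUnit (blockToeplitz r n) := by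
  have ht : (blockToeplitz r n).BlockTriangular Prod.fst := by
    intro a b hab
    have : ¬ a.1 ≤ b.1 := not_le.mpr hab
    simp [blockToeplitz, blockMatrix, this]
  rw [Matrix.isUnit_iff_isUnit_det, ht.det_fintype]
  rw [prod_eq_one]
  · exact isUnit_one
  · intro k _
    convert Matrix.det_one (R := ℂ) (n := {a : Fin n × Fin q // a.1 = k})
    ext ⟨⟨a, x⟩, ha⟩ ⟨⟨b, y⟩, hb⟩
    simp only at ha hb
    subst ha hb
    simp [Matrix.toSquareBlock, Matrix.toSquareBlockProp, blockToeplitz, blockMatrix, hr,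
      Matrix.one_apply, Subtype.ext_iff]

end BlockMatrix

/-! ### Schur complements of positive semidefinite block matrices -/

section SchurComplement

/-- The matrix `Y` with the block `B` appended below. -/
def stack {m q : ℕ} {ι : Type*} (Y : Matrix (Fin m × Fin q) ι ℂ) (B : Matrix (Fin q) ι ℂ) :
    Matrix (Fin (m + 1) × Fin q) ι ℂ :=
  Matrix.of fun a y => Fin.lastCases (motive := fun _ => ℂ) (B a.2 y) (fun i => Y (i, a.2) y) a.1

section Stack

variable {m q : ℕ} {ι : Type*} (Y : Matrix (Fin m × Fin q) ι ℂ) (B : Matrix (Fin q) ι ℂ)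

@[simp] theorem stack_last (x : Fin q) (y : ι) : stack Y B (Fin.last m, x) y = B x y := by
  simp [stack]

@[simp] theorem stack_castSucc (i : Fin m) (x : Fin q) (y : ι) :
    stack Y B (i.castSucc, x) y = Y (i, x) y := by
  simp [stack]

theorem stack_ext {A C : Matrix (Fin (m + 1) × Fin q) ι ℂ}
    (h1 : ∀ i x y, A (Fin.castSucc i, x) y = C (Fin.castSucc i, x) y)
    (h2 : ∀ x y, A (Fin.last m, x) y = C (Fin.last m, x) y) : A = C := by
  ext ⟨i, x⟩ y
  induction i using Fin.lastCases with
  | last => exact h2 x y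
  | cast i => exact h1 i x y

theorem conjTranspose_stack_mul_stack {κ : Type*} (Y' : Matrix (Fin m × Fin q) κ ℂ)
    (B' : Matrix (Fin q) κ ℂ) : (stack Y B)ᴴ * stack Y' B' = Yᴴ * Y' + Bᴴ * B' := by
  ext x y
  simp [Matrix.mul_apply, Fintype.sum_prod_type, Fin.sum_univ_castSucc]

end Stack

theorem blockHankel_succ_mul_stack {q n : ℕ} {ι : Type*} (s : MatSeq q q)
    (Y : Matrix (Fin (n + 1) × Fin q) ι ℂ) (B : Matrix (Fin q) ι ℂ) :
    blockHankel s (n + 1) * stack Y B =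
      stack (blockHankel s n * Y + blockCol s (n + 1) (n + 1) * B)
        (blockRow s (n + 1) (n + 1) * Y + s (2 * (n + 1)) * B) := by
  refine stack_ext (fun i x y => ?_) fun x y => ?_
  · simp [Matrix.mul_apply, Fintype.sum_prod_type, Fin.sum_univ_castSucc (n := n + 1), blockHankel,
      blockCol, add_comm]
  · simp [Matrix.mul_apply, Fintype.sum_prod_type, Fin.sum_univ_castSucc (n := n + 1), blockHankel,
      blockRow, two_mul]

/-- `L` is the Schur complement of the block matrix `A` with respect to its last diagonal block. -/
def HasSchurComplement {m q : ℕ} (A : Matrix (Fin (m + 1) × Fin q) (Fin (m + 1) × Fin q) ℂ)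
    (L : Matrix (Fin q) (Fin q) ℂ) : Prop :=
  ∃ Y : Matrix (Fin m × Fin q) (Fin q) ℂ, A * stack Y 1 = stack 0 L

/-- No invertibility is needed: pairing the two solution columns through `A` gives `K = K'ᴴ` for any
two Schur complements. Taking them equal shows that each is Hermitian. -/
theorem HasSchurComplement.unique {m q : ℕ}
    {A : Matrix (Fin (m + 1) × Fin q) (Fin (m + 1) × Fin q) ℂ} (hA : Aᴴ = A)
    {L L' : Matrix (Fin q) (Fin q) ℂ} (h : HasSchurComplement A L)
    (h' : HasSchurComplement A L') : L = L' := by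
  have key : ∀ {K K' : Matrix (Fin q) (Fin q) ℂ}, HasSchurComplement A K →
      HasSchurComplement A K' → K = K'ᴴ := by
    rintro K K' ⟨Y, hY⟩ ⟨Y', hY'⟩
    have h1 : (stack Y' 1)ᴴ * (A * stack Y 1) = K := by
      rw [hY, conjTranspose_stack_mul_stack]; simp
    have h2 : (stack Y' 1)ᴴ * (A * stack Y 1) = K'ᴴ := by
      rw [← Matrix.mul_assoc]
      nth_rewrite 1 [← hA]
      rw [← Matrix.conjTranspose_mul, hY', conjTranspose_stack_mul_stack]
      simp
    rw [← h1, h2]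
  rw [key h h', ← key h' h']

theorem PosSemidef.mul_eq_zero {m ι : Type*} [Fintype m] [Fintype ι] {A : Matrix m m ℂ}
    (hA : A.PosSemidef) {Z : Matrix m ι ℂ} (h : Zᴴ * (A * Z) = 0) : A * Z = 0 := by
  classical
  ext i j
  have hj : star (fun k => Z k j) ⬝ᵥ (A *ᵥ fun k => Z k j) = 0 := by
    have := congrFun (congrFun h j) j
    simpa [Matrix.mul_apply, dotProduct, Matrix.mulVec] using this
  have := congrFun ((hA.dotProduct_mulVec_zero_iff _).mp hj) i
  simpa [Matrix.mul_apply, dotProduct, Matrix.mulVec] using this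

theorem moorePenrose_conjTranspose {n : Type*} [Fintype n] {A : Matrix n n ℂ} (hA : Aᴴ = A) :
    (moorePenrose A)ᴴ = moorePenrose A := by
  have h := moorePenrose_spec A
  refine IsMoorePenrose.unique (A := A) ⟨?_, ?_, ?_, ?_⟩ h
  · simpa [Matrix.mul_assoc, hA] using congrArg Matrix.conjTranspose h.mul_mul_left
  · simpa [Matrix.mul_assoc, hA] using congrArg Matrix.conjTranspose h.mul_mul_right
  · have := h.right_hermitian
    rw [Matrix.conjTranspose_mul, hA] at this
    rw [this, ← this, Matrix.conjTranspose_mul, hA, Matrix.conjTranspose_conjTranspose, this]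
  · have := h.left_hermitian
    rw [Matrix.conjTranspose_mul, hA] at this
    rw [this, ← this, Matrix.conjTranspose_mul, hA, Matrix.conjTranspose_conjTranspose, this]

theorem mul_moorePenrose_comm {n : Type*} [Fintype n] {A : Matrix n n ℂ} (hA : Aᴴ = A) :
    A * moorePenrose A = moorePenrose A * A := by
  have := (moorePenrose_spec A).left_hermitian
  rwa [Matrix.conjTranspose_mul, hA, moorePenrose_conjTranspose hA, eq_comm] at this

theorem posSemidef_blockHankel_of_le {q m n : ℕ} {s : MatSeq q q}
    (h : (blockHankel s n).PosSemidef) (hm : m ≤ n) : (blockHankel s m).PosSemidef :=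
  h.submatrix fun a : Fin (m + 1) × Fin q => (Fin.castLE (by omega) a.1, a.2)

theorem hasSchurComplement_schurL {q n : ℕ} {s : MatSeq q q}
    (h : (blockHankel s n).PosSemidef) : HasSchurComplement (blockHankel s n) (schurL s n) := by
  cases n with
  | zero =>
    refine ⟨0, stack_ext (fun i => i.elim0) fun x y => ?_⟩
    simp only [stack_last, Matrix.mul_apply, Fintype.sum_prod_type,
      Fin.sum_univ_castSucc (n := 0), Finset.univ_eq_empty, Finset.sum_empty, zero_add]
    simp [blockHankel, schurL, Matrix.one_apply]
  | succ n =>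
    have hH : (blockHankel s n)ᴴ = blockHankel s n :=
      (posSemidef_blockHankel_of_le h n.le_succ).isHermitian
    set H := blockHankel s n with hHdef
    have hcol : (blockRow s (n + 1) (n + 1))ᴴ = blockCol s (n + 1) (n + 1) := by
      ext ⟨i, x⟩ y
      have := congrFun (congrFun h.isHermitian (i.castSucc, x)) (Fin.last _, y)
      simpa [blockHankel, blockRow, blockCol, add_comm] using this
    have hMP := moorePenrose_spec H
    have hN : H * (1 - moorePenrose H * H) = 0 := by
      rw [mul_sub, mul_one, ← mul_assoc, hMP.mul_mul_left, sub_self]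
    -- The columns of `1 - H^† H` lie in the kernel of `H`. Padded by zero they are isotropic for
    -- the larger semidefinite matrix, hence in its kernel; the last block row of this says that the
    -- block row vanishes there.
    have hZ := PosSemidef.mul_eq_zero h
      (Z := stack (1 - moorePenrose H * H) (0 : Matrix (Fin q) (Fin (n + 1) × Fin q) ℂ)) (by
        rw [blockHankel_succ_mul_stack, conjTranspose_stack_mul_stack, ← hHdef, hN]; simp)
    have hrow : blockRow s (n + 1) (n + 1) * (1 - moorePenrose H * H) = 0 := by
      ext x y
      have := congrFun (congrFun hZ (Fin.last _, x)) y
      rw [blockHankel_succ_mul_stack, stack_last] at this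
      simpa using this
    rw [Matrix.mul_sub, Matrix.mul_one, sub_eq_zero] at hrow
    -- The adjoint of the kernel condition: the block column lies in the range of `H`.
    have hc : H * (moorePenrose H * blockCol s (n + 1) (n + 1)) = blockCol s (n + 1) (n + 1) := by
      rw [← Matrix.mul_assoc, ← hcol]
      nth_rewrite 2 [hrow]
      rw [Matrix.conjTranspose_mul, hMP.right_hermitian, mul_moorePenrose_comm hH]
    refine ⟨-(moorePenrose H * blockCol s (n + 1) (n + 1)), ?_⟩
    rw [blockHankel_succ_mul_stack, schurL, ← hHdef]
    congr 1
    · rw [Matrix.mul_neg, hc, Matrix.mul_one, neg_add_cancel]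
    · rw [Matrix.mul_neg, Matrix.mul_one, Matrix.mul_assoc]
      abel

theorem blockToeplitz_mul_stack {q m : ℕ} {r : MatSeq q q} (hr : r 0 = 1)
    (Y : Matrix (Fin m × Fin q) (Fin q) ℂ) :
    ∃ Y', blockToeplitz r (m + 1) * stack Y 1 = stack Y' 1 := by
  refine ⟨Matrix.of fun a y => (blockToeplitz r (m + 1) * stack Y 1) (a.1.castSucc, a.2) y,
    stack_ext (fun i x y => ?_) fun x y => ?_⟩
  · simp
  · simp [Matrix.mul_apply, Fintype.sum_prod_type, Fin.sum_univ_castSucc, blockToeplitz,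
      blockMatrix, hr, Matrix.one_apply]

theorem conjTranspose_blockToeplitz_mul_stack {q m : ℕ} {r : MatSeq q q} (hr : r 0 = 1)
    (L : Matrix (Fin q) (Fin q) ℂ) :
    (blockToeplitz r (m + 1))ᴴ * stack (0 : Matrix (Fin m × Fin q) (Fin q) ℂ) L = stack 0 L := by
  refine stack_ext (fun i x y => ?_) fun x y => ?_
  · have : ¬ Fin.last m ≤ i.castSucc := not_le.mpr i.castSucc_lt_last
    rw [Matrix.mul_apply, Fintype.sum_prod_type, Fin.sum_univ_castSucc]
    simp [Matrix.conjTranspose_apply, blockToeplitz, blockMatrix, this]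
  · rw [Matrix.mul_apply, Fintype.sum_prod_type, Fin.sum_univ_castSucc]
    simp [Matrix.conjTranspose_apply, blockToeplitz, blockMatrix, hr, Matrix.one_apply, apply_ite]

/-- A unit upper triangular factor keeps the last block of `stack Y 1` equal to `1`, and its adjoint
fixes `stack 0 L`. The invertible adjoint can therefore be cancelled. -/
theorem HasSchurComplement.of_conj {q m : ℕ} {r : MatSeq q q} (hr : r 0 = 1)
    {A : Matrix (Fin (m + 1) × Fin q) (Fin (m + 1) × Fin q) ℂ} {L : Matrix (Fin q) (Fin q) ℂ}
    (h : HasSchurComplement ((blockToeplitz r (m + 1))ᴴ * A * blockToeplitz r (m + 1)) L) :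
    HasSchurComplement A L := by
  obtain ⟨Y, hY⟩ := h
  obtain ⟨Y', hY'⟩ := blockToeplitz_mul_stack hr Y
  refine ⟨Y', ?_⟩
  obtain ⟨U, hU⟩ : IsUnit (blockToeplitz r (m + 1))ᴴ := (isUnit_blockToeplitz hr (m + 1)).star
  rw [Matrix.mul_assoc, hY', Matrix.mul_assoc, ← conjTranspose_blockToeplitz_mul_stack hr L,
    ← hU] at hY
  have := congrArg (fun M => (U⁻¹).val * M) hY
  simpa [← Matrix.mul_assoc] using this

theorem posSemidef_of_conj {q m : ℕ} {r : MatSeq q q} (hr : r 0 = 1)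
    {A : Matrix (Fin m × Fin q) (Fin m × Fin q) ℂ}
    (h : ((blockToeplitz r m)ᴴ * A * blockToeplitz r m).PosSemidef) : A.PosSemidef :=
  (Matrix.IsUnit.posSemidef_star_left_conjugate_iff (isUnit_blockToeplitz hr m)).mp h

theorem HasSchurComplement.of_borderKernel {q m : ℕ} {c : Matrix (Fin q) (Fin q) ℂ}
    {D : ℕ → ℕ → Matrix (Fin q) (Fin q) ℂ} {L : Matrix (Fin q) (Fin q) ℂ}
    (h : HasSchurComplement (blockMatrix (m + 1 + 1) (m + 1 + 1) (borderKernel c D)) L) :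
    HasSchurComplement (blockMatrix (m + 1) (m + 1) D) L := by
  obtain ⟨Y, hY⟩ := h
  have htail : ∀ (Y : Matrix (Fin (m + 1) × Fin q) (Fin q) ℂ) (B : Matrix (Fin q) (Fin q) ℂ) k x y,
      stack Y B (Fin.succ k, x) y =
        stack (Matrix.of fun (a : Fin m × Fin q) y => Y (a.1.succ, a.2) y) B (k, x) y := by
    intro Y B k x y
    induction k using Fin.lastCases with
    | last => rw [Fin.succ_last, stack_last, stack_last]
    | cast k => rw [Fin.succ_castSucc, stack_castSucc, stack_castSucc]; rfl
  refine ⟨Matrix.of fun a y => Y (a.1.succ, a.2) y, ?_⟩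
  ext ⟨k, x⟩ y
  have := congrFun (congrFun hY (k.succ, x)) y
  rw [htail, show (Matrix.of fun (a : Fin m × Fin q) y =>
    (0 : Matrix (Fin (m + 1) × Fin q) (Fin q) ℂ) (a.1.succ, a.2) y) = 0 from rfl] at this
  simp only [Matrix.mul_apply, Fintype.sum_prod_type, Fin.sum_univ_succ (n := m + 1), htail] at this
  simpa [blockMatrix, borderKernel, Matrix.mul_apply, Fintype.sum_prod_type] using this

theorem posSemidef_of_borderKernel {q m : ℕ} {c : Matrix (Fin q) (Fin q) ℂ}
    {D : ℕ → ℕ → Matrix (Fin q) (Fin q) ℂ}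
    (h : (blockMatrix (m + 1) (m + 1) (borderKernel c D)).PosSemidef) :
    (blockMatrix m m D).PosSemidef :=
  h.submatrix fun a : Fin m × Fin q => (a.1.succ, a.2)

/-- Placing `N` in block `i` gives an isotropic block column, since only the diagonal block `s (i +
i)` enters the form. Semidefiniteness then kills the entire block column `i` times `N`. -/
theorem mul_eq_zero_of_posSemidef_blockHankel {q n i : ℕ} {s : MatSeq q q}
    (h : (blockHankel s n).PosSemidef) (hi : i ≤ n) {N : Matrix (Fin q) (Fin q) ℂ}
    (hN : s (i + i) * N = 0) (k : ℕ) (hk : k ≤ n) : s (k + i) * N = 0 := by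
  let Z : Matrix (Fin (n + 1) × Fin q) (Fin 1 × Fin q) ℂ :=
    blockMatrix (n + 1) 1 fun a _ => if a = i then N else 0
  have hm : blockHankel s n * Z = blockMatrix (n + 1) 1 fun a _ => s (a + i) * N := by
    rw [blockHankel_eq_blockMatrix, blockMatrix_mul]
    refine blockMatrix_congr fun a _ b _ => ?_
    simp only [mul_ite, mul_zero]
    rw [Finset.sum_ite_eq' (Finset.range (n + 1)) i, if_pos (by simp; omega)]
  have hZ := PosSemidef.mul_eq_zero h (Z := Z) (by
    rw [hm, blockMatrix_conjTranspose, blockMatrix_mul]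
    ext x y
    rw [blockMatrix, Matrix.of_apply, Finset.sum_eq_zero]
    · rfl
    · intro a _
      split_ifs with ha
      · rw [ha, hN, mul_zero]
      · rw [Matrix.conjTranspose_zero, zero_mul])
  rw [hm] at hZ
  ext x y
  exact congrFun (congrFun hZ (⟨k, by omega⟩, x)) (0, y)

end SchurComplement

/-! ### Dependence on finitely many terms -/

section Locality

variable {q : ℕ} {α : ℂ} {s t : MatSeq q q}

theorem blockHankel_congr {n : ℕ} (h : ∀ j ≤ 2 * n, s j = t j) :
    blockHankel s n = blockHankel t n :=
  blockMatrix_congr fun i hi j hj => h _ (by omega)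

theorem rightShift_congr {n : ℕ} (h : ∀ j ≤ n + 1, s j = t j) :
    ∀ j ≤ n, rightShift α s j = rightShift α t j := by
  intro j hj
  rw [rightShift, rightShift, h j (by omega), h (j + 1) (by omega)]

theorem schurL_congr {n : ℕ} (h : ∀ j ≤ 2 * n, s j = t j) : schurL s n = schurL t n := by
  cases n with
  | zero => exact h 0 le_rfl
  | succ n =>
    have h1 : blockRow s (n + 1) (n + 1) = blockRow t (n + 1) (n + 1) := by
      ext x y
      simp only [blockRow, Matrix.of_apply]
      rw [h _ (by omega)]
    have h2 : blockCol s (n + 1) (n + 1) = blockCol t (n + 1) (n + 1) := by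
      ext x y
      simp only [blockCol, Matrix.of_apply]
      rw [h _ (by omega)]
    rw [schurL, schurL, h _ le_rfl, h1, h2, blockHankel_congr fun j hj => h j (by omega)]

theorem plusTransform_congr {n : ℕ} (h : ∀ j ≤ n, s j = t j) :
    ∀ j ≤ n, plusTransform α s j = plusTransform α t j := by
  rintro (_ | j) hj
  · exact h 0 hj
  · rw [plusTransform, plusTransform, h j (by omega), h (j + 1) hj]

theorem reciprocal_congr {n : ℕ} (h : ∀ j ≤ n, s j = t j) :
    ∀ j ≤ n, reciprocal s j = reciprocal t j := by
  intro j
  induction j using Nat.strong_induction_on with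
  | _ j ih =>
    intro hj
    cases j with
    | zero => rw [reciprocal, reciprocal, h 0 hj]
    | succ j =>
      rw [reciprocal, reciprocal, h 0 (by omega)]
      congr 2
      refine Finset.sum_congr rfl fun l _ => ?_
      rw [h _ (by omega), ih l (by omega) (by omega)]

theorem schurTransform_congr {n : ℕ} (h : ∀ j ≤ n + 1, s j = t j) :
    ∀ j ≤ n, schurTransform α s j = schurTransform α t j := by
  intro j hj
  rw [schurTransform, schurTransform, h 0 (by omega),
    reciprocal_congr (plusTransform_congr h) (j + 1) (by omega)]

theorem iterSchurTransform_succ (k : ℕ) :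
    iterSchurTransform α s (k + 1) = iterSchurTransform α (schurTransform α s) k := by
  induction k with
  | zero => rfl
  | succ k ih => rw [iterSchurTransform, ih, iterSchurTransform]

theorem iterSchurTransform_congr {k : ℕ} (h : ∀ j ≤ k, s j = t j) :
    iterSchurTransform α s k 0 = iterSchurTransform α t k 0 := by
  induction k generalizing s t with
  | zero => exact h 0 le_rfl
  | succ k ih =>
    rw [iterSchurTransform_succ, iterSchurTransform_succ]
    exact ih (schurTransform_congr h)

end Locality

/-! ### Stieltjes non-negative definite sequences -/

/-- All block Hankel matrices built from `s_0, …, s_m` and from `-α s_0 + s_1, …, -α s_{m-1} + s_m`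
are non-negative. -/
structure HankelNonneg {q : ℕ} (α : ℝ) (m : ℕ) (s : MatSeq q q) : Prop where
  even : ∀ n : ℕ, 2 * n ≤ m → (blockHankel s n).PosSemidef
  odd : ∀ n : ℕ, 2 * n + 1 ≤ m → (blockHankel (rightShift (α : ℂ) s) n).PosSemidef

section HankelNonneg

variable {q m : ℕ} {α : ℝ} {s t : MatSeq q q}

theorem IsStieltjesNonnegFin.hankelNonneg (h : IsStieltjesNonnegFin α m s) :
    HankelNonneg α m s := by
  obtain ⟨h0, h1, h2⟩ := h
  rcases Nat.even_or_odd' m with ⟨n, rfl | rfl⟩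
  · rcases n with _ | n
    · exact ⟨fun k hk => posSemidef_blockHankel_of_le (h0 rfl) (by omega), fun k hk => by omega⟩
    · obtain ⟨ha, hb⟩ := h1 n rfl
      exact ⟨fun k hk => posSemidef_blockHankel_of_le ha (by omega),
        fun k hk => posSemidef_blockHankel_of_le hb (by omega)⟩
  · obtain ⟨ha, hb⟩ := h2 n rfl
    exact ⟨fun k hk => posSemidef_blockHankel_of_le ha (by omega),
      fun k hk => posSemidef_blockHankel_of_le hb (by omega)⟩

theorem HankelNonneg.mono (h : HankelNonneg α m s) {k : ℕ} (hk : k ≤ m) : HankelNonneg α k s :=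
  ⟨fun n hn => h.even n (hn.trans hk), fun n hn => h.odd n (hn.trans hk)⟩

theorem HankelNonneg.congr (h : HankelNonneg α m s) (hst : ∀ j ≤ m, s j = t j) :
    HankelNonneg α m t := by
  refine ⟨fun n hn => ?_, fun n hn => ?_⟩
  · rw [← blockHankel_congr (s := s) fun j hj => hst j (by omega)]
    exact h.even n hn
  · rw [← blockHankel_congr (s := rightShift (α : ℂ) s)
      (rightShift_congr fun j hj => hst j (by omega))]
    exact h.odd n hn

theorem isHermitian_of_posSemidef_blockHankel {n : ℕ} (h : (blockHankel s n).PosSemidef) :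
    (s (2 * n))ᴴ = s (2 * n) := by
  ext x y
  have := congrFun (congrFun h.isHermitian (Fin.last n, x)) (Fin.last n, y)
  simpa [blockHankel, two_mul] using this

theorem HankelNonneg.isHermitian (h : HankelNonneg α m s) {j : ℕ} (hj : j ≤ m) :
    (s j)ᴴ = s j := by
  rcases Nat.even_or_odd' j with ⟨n, rfl | rfl⟩
  · exact isHermitian_of_posSemidef_blockHankel (h.even n hj)
  · have h0 := isHermitian_of_posSemidef_blockHankel (h.even n (by omega))
    have h1 := isHermitian_of_posSemidef_blockHankel (h.odd n hj)
    simpa [rightShift, h0] using h1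

/-- The kernel inclusion climbs one index at a time: odd indices come from the Hankel matrices of
`s`, even ones from those of `rightShift α s`. Reaching index `j` uses a matrix that contains `s (j
+ 1)`, hence the bound `j ≤ m`. -/
theorem HankelNonneg.mul_eq_zero (h : HankelNonneg α (m + 1) s) {N : Matrix (Fin q) (Fin q) ℂ}
    (hN : s 0 * N = 0) (j : ℕ) (hj : j ≤ m) : s j * N = 0 := by
  induction j using Nat.strong_induction_on with
  | _ j ih =>
    rcases Nat.even_or_odd' j with ⟨n, rfl | rfl⟩
    · rcases n with _ | n
      · exact hN
      · have h0 := ih (2 * n) (by omega) (by omega)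
        have h1 := ih (2 * n + 1) (by omega) (by omega)
        have h2 : rightShift (α : ℂ) s (n + 1 + n) * N = 0 := by
          refine mul_eq_zero_of_posSemidef_blockHankel (h.odd (n + 1) (by omega)) n.le_succ ?_ _
            le_rfl
          rw [rightShift, ← two_mul, add_mul, neg_mul, smul_mul_assoc, h0, h1]
          simp
        rw [rightShift, show n + 1 + n = 2 * n + 1 by omega, add_mul, neg_mul, smul_mul_assoc, h1,
          smul_zero, neg_zero, zero_add] at h2
        exact h2
    · have h0 := ih (2 * n) (by omega) (by omega)
      have := mul_eq_zero_of_posSemidef_blockHankel (h.even (n + 1) (by omega)) n.le_succ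
        (N := N) (by rwa [← two_mul]) _ le_rfl
      rwa [show n + 1 + n = 2 * n + 1 by omega] at this

theorem HankelNonneg.compress (h : HankelNonneg α m s) {P : Matrix (Fin q) (Fin q) ℂ}
    (hP : Pᴴ = P) : HankelNonneg α m fun j => P * s j * P := by
  have key : ∀ (v : MatSeq q q) (n : ℕ), (blockHankel v n).PosSemidef →
      (blockHankel (fun j => P * v j * P) n).PosSemidef := by
    intro v n hv
    have := hv.conjTranspose_mul_mul_same
      (blockMatrix (n + 1) (n + 1) fun a b => if a = b then P else 0)
    convert this using 1
    rw [blockHankel_eq_blockMatrix, blockHankel_eq_blockMatrix, blockMatrix_conjTranspose,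
      blockMatrix_mul, blockMatrix_mul]
    refine blockMatrix_congr fun i hi j hj => ?_
    simp only [mul_ite, mul_zero]
    rw [Finset.sum_ite_eq', if_pos (Finset.mem_range.mpr hj), Finset.sum_eq_single i]
    · rw [if_pos rfl, hP]
    · intro a _ ha
      rw [if_neg ha, Matrix.conjTranspose_zero, zero_mul]
    · intro hi'
      exact absurd (Finset.mem_range.mpr hi) hi'
  refine ⟨fun n hn => key s n (h.even n hn), fun n hn => ?_⟩
  convert key _ n (h.odd n hn) using 2
  funext j
  simp only [rightShift, mul_add, add_mul, mul_neg, neg_mul, mul_smul_comm, smul_mul_assoc]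

end HankelNonneg

/-! ### The Schur-Stieltjes transform of a normalized sequence -/

/-- A sequence of Hermitian matrices whose ranges are contained in the range of the first one. -/
structure IsDominated {q : ℕ} (t : MatSeq q q) : Prop where
  isHermitian : ∀ j, (t j)ᴴ = t j
  left : ∀ j, t 0 * moorePenrose (t 0) * t j = t j
  right : ∀ j, t j * moorePenrose (t 0) * t 0 = t j

/-- A non-negative sequence coincides, up to its last term, with a dominated one. -/
theorem HankelNonneg.exists_isDominated {q m : ℕ} {α : ℝ} {s : MatSeq q q}
    (h : HankelNonneg α (m + 1) s) :
    ∃ t : MatSeq q q, IsDominated t ∧ HankelNonneg α (m + 1) t ∧ ∀ j ≤ m, t j = s j := by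
  have hMP := moorePenrose_spec (s 0)
  have h0 : (s 0)ᴴ = s 0 := h.isHermitian (Nat.zero_le _)
  have hcomm := mul_moorePenrose_comm h0
  obtain ⟨P, hPdef⟩ : ∃ P, P = s 0 * moorePenrose (s 0) := ⟨_, rfl⟩
  have hP : Pᴴ = P := by rw [hPdef, hMP.left_hermitian]
  have hPP : P * P = P := by rw [hPdef, ← Matrix.mul_assoc, hMP.mul_mul_left]
  have hr : ∀ j ≤ m, s j * P = s j := by
    intro j hj
    have := h.mul_eq_zero (N := 1 - P) (by
      rw [mul_sub, mul_one, hPdef, hcomm, ← Matrix.mul_assoc, hMP.mul_mul_left, sub_self]) j hj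
    rwa [mul_sub, mul_one, sub_eq_zero, eq_comm] at this
  have hl : ∀ j ≤ m, P * s j = s j := by
    intro j hj
    have := congrArg Matrix.conjTranspose (hr j hj)
    rwa [Matrix.conjTranspose_mul, hP, h.isHermitian (by omega)] at this
  have ht : ∀ j ≤ m, (if j ≤ m + 1 then P * s j * P else 0) = s j := by
    intro j hj
    rw [if_pos (by omega), hl j hj, hr j hj]
  -- Domination is required at every index. Compression by `P` fixes the terms up to `m` and
  -- corrects the term `m + 1`; later terms need not be Hermitian and are set to zero.
  refine ⟨fun j => if j ≤ m + 1 then P * s j * P else 0, ⟨?_, ?_, ?_⟩, ?_, ht⟩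
  · intro j
    split_ifs with hj
    · rw [Matrix.conjTranspose_mul, Matrix.conjTranspose_mul, hP, h.isHermitian hj,
        Matrix.mul_assoc]
    · exact Matrix.conjTranspose_zero
  · intro j
    rw [ht 0 (Nat.zero_le _), ← hPdef]
    split_ifs with hj
    · rw [← Matrix.mul_assoc, ← Matrix.mul_assoc, hPP]
    · exact mul_zero _
  · intro j
    rw [ht 0 (Nat.zero_le _), Matrix.mul_assoc, ← hcomm, ← hPdef]
    split_ifs with hj
    · rw [Matrix.mul_assoc, hPP]
    · exact zero_mul _
  · exact (h.compress hP).congr fun j hj => (if_pos hj).symm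

section Transform

variable {q : ℕ} {α : ℝ} {t : MatSeq q q}

theorem IsDominated.plusTransform_left (ht : IsDominated t) (j : ℕ) :
    t 0 * moorePenrose (t 0) * plusTransform (α : ℂ) t j = plusTransform (α : ℂ) t j := by
  cases j with
  | zero => exact ht.left 0
  | succ j => rw [plusTransform, mul_add, mul_neg, mul_smul_comm, ht.left, ht.left]

theorem IsDominated.plusTransform_right (ht : IsDominated t) (j : ℕ) :
    plusTransform (α : ℂ) t j * moorePenrose (t 0) * t 0 = plusTransform (α : ℂ) t j := by
  cases j with
  | zero => exact ht.right 0
  | succ j =>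
    rw [plusTransform, add_mul, add_mul, neg_mul, neg_mul, smul_mul_assoc, smul_mul_assoc,
      ht.right, ht.right]

theorem IsDominated.plusTransform_isHermitian (ht : IsDominated t) (j : ℕ) :
    (plusTransform (α : ℂ) t j)ᴴ = plusTransform (α : ℂ) t j := by
  cases j with
  | zero => exact ht.isHermitian 0
  | succ j => simp [plusTransform, ht.isHermitian]

theorem IsDominated.schurTransform_convolution (ht : IsDominated t) (j : ℕ) :
    ∑ b ∈ Finset.range (j + 1), schurTransform (α : ℂ) t b *
        (moorePenrose (t 0) * plusTransform (α : ℂ) t (j - b)) = plusTransform (α : ℂ) t (j + 1) ∧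
    ∑ a ∈ Finset.range (j + 1), (plusTransform (α : ℂ) t (j - a) * moorePenrose (t 0)) *
        schurTransform (α : ℂ) t a = plusTransform (α : ℂ) t (j + 1) :=
  transform_convolution (u := plusTransform (α : ℂ) t)
    (y := reciprocal (plusTransform (α : ℂ) t)) (fun j => ht.plusTransform_left j)
    (fun j => ht.plusTransform_right j) (moorePenrose_spec (t 0)).mul_mul_right
    (by rw [reciprocal]; rfl) (fun j => by rw [reciprocal]; rfl) j

theorem schurTransform_left (j : ℕ) :
    t 0 * moorePenrose (t 0) * schurTransform (α : ℂ) t j = schurTransform (α : ℂ) t j := by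
  rw [schurTransform, ← Matrix.mul_assoc, ← Matrix.mul_assoc,
    (moorePenrose_spec (t 0)).mul_mul_left]

theorem schurTransform_right (j : ℕ) :
    schurTransform (α : ℂ) t j * (moorePenrose (t 0) * t 0) = schurTransform (α : ℂ) t j := by
  rw [schurTransform, Matrix.mul_assoc, ← Matrix.mul_assoc (t 0),
    (moorePenrose_spec (t 0)).mul_mul_left]

theorem conjTranspose_monic {x y : MatSeq q q} (h : ∀ j, x j = (y j)ᴴ) (j : ℕ) :
    monic x j = (monic y j)ᴴ := by
  cases j with
  | zero => exact Matrix.conjTranspose_one.symm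
  | succ j => exact h _

theorem IsDominated.blockHankel_rightShift (ht : IsDominated t) (n : ℕ) :
    blockHankel (rightShift (α : ℂ) t) n =
      (blockToeplitz (monic fun j => moorePenrose (t 0) * plusTransform (α : ℂ) t j) (n + 1))ᴴ *
        blockHankel (schurTransform (α : ℂ) t) n *
        blockToeplitz (monic fun j => moorePenrose (t 0) * plusTransform (α : ℂ) t j) (n + 1) := by
  have hl := conjTranspose_monic (x := fun j => plusTransform (α : ℂ) t j * moorePenrose (t 0))
    (y := fun j => moorePenrose (t 0) * plusTransform (α : ℂ) t j) fun j => by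
      rw [Matrix.conjTranspose_mul, ht.plusTransform_isHermitian,
        moorePenrose_conjTranspose (ht.isHermitian 0)]
  have key := toeplitzConj_transform (u := plusTransform (α : ℂ) t) (e := moorePenrose (t 0))
    (v := schurTransform (α : ℂ) t)
    (schurTransform_right (α := α) (t := t)) (schurTransform_left (α := α) (t := t))
    (fun j => (ht.schurTransform_convolution j).1)
    (fun j => (ht.schurTransform_convolution j).2)
  rw [blockHankel_eq_blockMatrix, blockHankel_eq_blockMatrix, blockToeplitz_conj fun j _ => hl j]
  refine blockMatrix_congr fun i _ j _ => ?_
  rw [key i j]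
  rfl

theorem IsDominated.blockHankel_succ (ht : IsDominated t) (n : ℕ) :
    blockHankel t (n + 1) =
      (blockToeplitz (monic fun j => moorePenrose (t 0) * t j) (n + 1 + 1))ᴴ *
        blockMatrix (n + 1 + 1) (n + 1 + 1) (borderKernel (t 0) fun a b =>
          rightShift (α : ℂ) (schurTransform (α : ℂ) t) (a + b)) *
        blockToeplitz (monic fun j => moorePenrose (t 0) * t j) (n + 1 + 1) := by
  have hl := conjTranspose_monic (x := fun j => t j * moorePenrose (t 0))
    (y := fun j => moorePenrose (t 0) * t j) fun j => by
      rw [Matrix.conjTranspose_mul, ht.isHermitian,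
        moorePenrose_conjTranspose (ht.isHermitian 0)]
  have key := toeplitzConj_borderKernel_transform (u := plusTransform (α : ℂ) t) (α := (α : ℂ))
    (t := t) (v := schurTransform (α : ℂ) t)
    (e := moorePenrose (t 0)) rfl (fun _ => rfl) ht.left ht.right
    (schurTransform_right (α := α) (t := t)) (schurTransform_left (α := α) (t := t))
    (fun j => (ht.schurTransform_convolution j).1)
    (fun j => (ht.schurTransform_convolution j).2)
  rw [blockHankel_eq_blockMatrix, blockToeplitz_conj fun j _ => hl j]
  refine blockMatrix_congr fun i _ j _ => ?_
  exact (key i j).symm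

theorem IsDominated.posSemidef_schurTransform (ht : IsDominated t) {n : ℕ}
    (h : (blockHankel (rightShift (α : ℂ) t) n).PosSemidef) :
    (blockHankel (schurTransform (α : ℂ) t) n).PosSemidef := by
  rw [ht.blockHankel_rightShift] at h
  exact posSemidef_of_conj rfl h

theorem IsDominated.posSemidef_rightShift_schurTransform (ht : IsDominated t) {n : ℕ}
    (h : (blockHankel t (n + 1)).PosSemidef) :
    (blockHankel (rightShift (α : ℂ) (schurTransform (α : ℂ) t)) n).PosSemidef := by
  rw [ht.blockHankel_succ (α := α)] at h
  exact posSemidef_of_borderKernel (posSemidef_of_conj rfl h)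

/-- The Schur-Stieltjes transform shifts the right Stieltjes parametrization: odd terms. -/
theorem IsDominated.schurL_schurTransform (ht : IsDominated t) {n : ℕ}
    (h : (blockHankel (rightShift (α : ℂ) t) n).PosSemidef) :
    schurL (schurTransform (α : ℂ) t) n = schurL (rightShift (α : ℂ) t) n := by
  have hV := ht.posSemidef_schurTransform h
  refine HasSchurComplement.unique hV.isHermitian (hasSchurComplement_schurL hV) ?_
  have := hasSchurComplement_schurL h
  rw [ht.blockHankel_rightShift] at this
  exact this.of_conj rfl

/-- The Schur-Stieltjes transform shifts the right Stieltjes parametrization: even terms. -/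
theorem IsDominated.schurL_rightShift_schurTransform (ht : IsDominated t) {n : ℕ}
    (h : (blockHankel t (n + 1)).PosSemidef) :
    schurL (rightShift (α : ℂ) (schurTransform (α : ℂ) t)) n = schurL t (n + 1) := by
  have hV := ht.posSemidef_rightShift_schurTransform (α := α) h
  refine HasSchurComplement.unique hV.isHermitian (hasSchurComplement_schurL hV) ?_
  have := hasSchurComplement_schurL h
  rw [ht.blockHankel_succ (α := α)] at this
  exact (this.of_conj rfl).of_borderKernel

theorem IsDominated.hankelNonneg_schurTransform (ht : IsDominated t) {m : ℕ}
    (h : HankelNonneg α (m + 1) t) : HankelNonneg α m (schurTransform (α : ℂ) t) :=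
  ⟨fun n hn => ht.posSemidef_schurTransform (h.odd n (by omega)),
    fun n hn => ht.posSemidef_rightShift_schurTransform (h.even (n + 1) (by omega))⟩

end Transform

/-- The right Stieltjes parametrization consists of the first terms of the iterated
Schur-Stieltjes transforms. -/
theorem HankelNonneg.iterSchurTransform_zero {q : ℕ} {α : ℝ} (m : ℕ) {s : MatSeq q q}
    (h : HankelNonneg α (m + 1) s) :
    (∀ k, m = 2 * k → iterSchurTransform (α : ℂ) s m 0 = schurL s k) ∧
    (∀ k, m = 2 * k + 1 →
      iterSchurTransform (α : ℂ) s m 0 = schurL (rightShift (α : ℂ) s) k) := by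
  induction m generalizing s with
  | zero =>
    refine ⟨fun k hk => ?_, fun k hk => by omega⟩
    obtain rfl : k = 0 := by omega
    rfl
  | succ m ih =>
    obtain ⟨t, ht, hn, hts⟩ := h.exists_isDominated
    obtain ⟨ih1, ih2⟩ := ih (ht.hankelNonneg_schurTransform hn)
    -- The first term of the `(m+1)`-st transform depends only on the terms up to `m + 1`, exactly
    -- those where `t` and `s` agree.
    rw [← iterSchurTransform_congr hts, iterSchurTransform_succ]
    refine ⟨fun k hk => ?_, fun k hk => ?_⟩
    · obtain ⟨n, rfl⟩ : ∃ n, k = n + 1 := ⟨k - 1, by omega⟩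
      rw [ih2 n (by omega), ht.schurL_rightShift_schurTransform (hn.even _ (by omega))]
      exact schurL_congr fun j hj => hts j (by omega)
    · rw [ih1 k (by omega), ht.schurL_schurTransform (hn.odd _ (by omega))]
      exact schurL_congr (rightShift_congr fun j hj => hts j (by omega))

/-- An extendable sequence agrees with arbitrarily long non-negative sequences. -/
theorem IsStieltjesNonnegExt.exists_hankelNonneg {q : ℕ} {α : ℝ} {κ : ℕ∞} {s : MatSeq q q}
    (hs : IsStieltjesNonnegExt α κ s) {m : ℕ} (hm : (m : ℕ∞) ≤ κ) :
    ∃ t : MatSeq q q, (∀ j ≤ m, t j = s j) ∧ HankelNonneg α (m + 1) t := by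
  induction κ using ENat.recTopCoe with
  | top => exact ⟨s, fun _ _ => rfl, (hs.2 rfl (m + 1)).hankelNonneg⟩
  | coe n =>
    have hmn : m ≤ n := by exact_mod_cast hm
    obtain ⟨t, ht, h⟩ := hs.1 n rfl
    exact ⟨t, fun j hj => ht j (hj.trans hmn), h.hankelNonneg.mono (by omega)⟩

end StieltjesSchur

end

theorem theoremT1615 {q : ℕ} (α : ℝ) (κ : ℕ∞)
    (s : StieltjesSchur.MatSeq q q) (hs : StieltjesSchur.IsStieltjesNonnegExt α κ s) :
    StieltjesSchur.IsRightStieltjesParam (α : ℂ) κ s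
      (fun j => StieltjesSchur.iterSchurTransform (α : ℂ) s j 0) := by
  refine ⟨fun k hk => ?_, fun k hk => ?_⟩
  · obtain ⟨t, hts, ht⟩ := hs.exists_hankelNonneg hk
    dsimp only
    rw [← StieltjesSchur.iterSchurTransform_congr hts, (ht.iterSchurTransform_zero _).1 k rfl]
    exact StieltjesSchur.schurL_congr hts
  · obtain ⟨t, hts, ht⟩ := hs.exists_hankelNonneg hk
    dsimp only
    rw [← StieltjesSchur.iterSchurTransform_congr hts, (ht.iterSchurTransform_zero _).2 k rfl]
    exact StieltjesSchur.schurL_congr (StieltjesSchur.rightShift_congr hts)
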